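/- Let $k$ be a field of characteristic $0$, let $S=k[x,y,z]$ and $\mathfrak m=(x,y,z)$. For an ideal $I\subseteq S$ with $\dim_k(S/I)<\infty$ let $T(I)=\operatorname{Hom}_S(I,S/I)$, the tangent space at $[I]$ to the Hilbert scheme of points of $\mathbf A^3$; it is a finite-dimensional $k$-vector space. Let $d,r,p$ be natural numbers and let $I\subseteq S$ be an ideal with $\dim_k(S/I)=d\le\binom{r+2}{3}$. Suppose that $I$ is Borel-fixed, that is, mapped onto itself by every $k$-algebra automorphism of $S$ given by $x_j\mapsto\sum_{i\le j}g_{ij}x_i$, where $(x_1,x_2,x_3)=(x,y,z)$ and $g=(g_{ij})$ is an invertible upper triangular $3\times3$ matrix over $k$. If $x^p\in I$ and $p\le\frac{3r+1}{4}$, then $$\dim_k T(I)\le\dim_k T(\mathfrak m^r).$$ (In particular, for $d=\binom{r+2}{3}$ this is the inequality $\dim_kT(I)\le\dim_kT(\mathfrak m^r)$ conjectured by Briançon and Iarrobino for all ideals of colength $d$.) -/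

import Mathlib

noncomputable section

namespace HilbPoints

/-- The linear change of coordinates of `k[x_1, …, x_n]` given by an invertible matrix `g`:
the `k`-algebra endomorphism with `x_j ↦ ∑ i, g i j * x_i`
(the usual action of `GL_n` on the span of the variables, with the variables as basis). -/
def coordChange {K : Type*} [Field K] {n : ℕ} (g : GL (Fin n) K) :
    MvPolynomial (Fin n) K →ₐ[K] MvPolynomial (Fin n) K :=
  MvPolynomial.aeval fun j => ∑ i, MvPolynomial.C ((g : Matrix (Fin n) (Fin n) K) i j) *
    MvPolynomial.X i

theorem coordChange_comp {K : Type*} [Field K] {n : ℕ} (g h : GL (Fin n) K) :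
    (coordChange g).comp (coordChange h) = coordChange (g * h) := by
  refine MvPolynomial.algHom_ext fun j => ?_
  simp only [coordChange, AlgHom.comp_apply, MvPolynomial.aeval_X, map_sum, map_mul,
    MvPolynomial.aeval_C, MvPolynomial.algebraMap_eq, Units.val_mul, Matrix.mul_apply,
    Finset.mul_sum, Finset.sum_mul]
  rw [Finset.sum_comm]
  refine Finset.sum_congr rfl fun k _ => Finset.sum_congr rfl fun i _ => ?_
  ring

theorem coordChange_one {K : Type*} [Field K] {n : ℕ} :
    coordChange (1 : GL (Fin n) K) = AlgHom.id K (MvPolynomial (Fin n) K) := by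
  refine MvPolynomial.algHom_ext fun j => ?_
  simp [coordChange, Matrix.one_apply, Finset.sum_ite_eq']

/-- `I` is Borel-fixed: `g(I) = I` for every invertible upper triangular matrix `g`.
As `coordChange g` is bijective, `Ideal.map` is here just the image of `I`. -/
def IsBorelFixed {K : Type*} [Field K] {n : ℕ} (I : Ideal (MvPolynomial (Fin n) K)) : Prop :=
  ∀ g : GL (Fin n) K, (g : Matrix (Fin n) (Fin n) K).BlockTriangular id →
    I.map (coordChange g) = I

/-- `[I]` is a `k`-point of the Hilbert scheme `Hilb^d 𝔸^n`: `dim_k (S / I) = d`, finite. -/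
def IsHilbPoint {K : Type*} [Field K] {n : ℕ} (d : ℕ) (I : Ideal (MvPolynomial (Fin n) K)) :
    Prop :=
  Module.Finite K (MvPolynomial (Fin n) K ⧸ I) ∧
    Module.finrank K (MvPolynomial (Fin n) K ⧸ I) = d

/-- The tangent space `T(I) = Hom_S(I, S / I)`, a `k`-vector space. -/
abbrev TangentSpace {K : Type*} [Field K] {n : ℕ} (I : Ideal (MvPolynomial (Fin n) K)) : Type _ :=
  I →ₗ[MvPolynomial (Fin n) K] (MvPolynomial (Fin n) K ⧸ I)

/-- The ideal `𝔪 = (x_1, …, x_n)` of the origin. -/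
def originIdeal (K : Type*) [Field K] (n : ℕ) : Ideal (MvPolynomial (Fin n) K) :=
  Ideal.span (Set.range MvPolynomial.X)

end HilbPoints

end

/-!
Invariance under the torus makes a Borel-fixed ideal `I` monomial. If `x ^ p ∈ I`, then `I` is cut
by the powers `x ^ i` with `i < p` into staircase ideals `I_i` of `k[y, z]` whose colengths add up
to at most `d`, and a tangent vector is determined by its value at `x ^ p` and its restrictions in
`Hom(I_i, S / I)`. By the Hilbert–Burch resolution of `I_i`, the space `Hom(I_i, S / I)` is the
kernel of a map `(S / I) ^ (a + 1) → (S / I) ^ a` with cokernel `Ext¹(I_i, S / I)`, so its dimension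
is `d` plus that of the cokernel. As `S / I` is generated over `k[y, z]` by `1, x, …, x ^ (p - 1)`,
the cokernel is spanned by `p` classes for each box under the staircase. Summing over `i` gives
`dim T(I) ≤ (2 * p + 1) * d`.

On the other side, `T(𝔪 ^ r)` contains every `k`-linear map from forms of degree `r` to forms of
degree `r - 1`, so its dimension is at least `(r + 2).choose 2 * (r + 1).choose 2`, and `p` is small
enough for this to be at least `(2 * p + 1) * (r + 2).choose 3`.
-/

namespace HilbPoints

open MvPolynomial

section MonomialIdeal

/-- Monomial ideals, characterised by containing every monomial that occurs in one of their
elements. -/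
def IsMonomialIdeal {σ R : Type*} [CommSemiring R] (I : Ideal (MvPolynomial σ R)) : Prop :=
  ∀ f ∈ I, ∀ u ∈ f.support, monomial u 1 ∈ I

theorem IsMonomialIdeal.linearIndependent_mk_monomial {σ R : Type*} [CommRing R]
    {I : Ideal (MvPolynomial σ R)} (hI : IsMonomialIdeal I) :
    LinearIndependent R fun u : {u : σ →₀ ℕ // monomial u (1 : R) ∉ I} =>
      Ideal.Quotient.mkₐ R I (monomial u.1 1) := by
  classical
  rw [linearIndependent_iff']
  intro s a hsum u hu
  by_contra hau
  have hmem : ∑ w ∈ s, monomial w.1 (a w) ∈ I := by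
    rw [← Ideal.Quotient.eq_zero_iff_mem, ← Ideal.Quotient.mkₐ_eq_mk R, map_sum, ← hsum]
    refine Finset.sum_congr rfl fun w _ => ?_
    rw [← map_smul, smul_monomial, smul_eq_mul, mul_one]
  have hcoeff : coeff u.1 (∑ w ∈ s, monomial w.1 (a w)) = a u := by
    rw [coeff_sum, Finset.sum_eq_single_of_mem u hu fun w _ hwu => by
      rw [coeff_monomial, if_neg (Subtype.coe_ne_coe.2 hwu)], coeff_monomial, if_pos rfl]
  exact u.2 (hI _ hmem _ (mem_support_iff.2 (hcoeff ▸ hau)))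

theorem aeval_C_mul_X_monomial {σ R : Type*} [CommSemiring R] (t : σ → R) (u : σ →₀ ℕ) (a : R) :
    aeval (fun j => C (t j) * X j) (monomial u a) =
      (u.prod fun j e => t j ^ e) • monomial u a := by
  rw [aeval_monomial, monomial_eq, smul_eq_C_mul, algebraMap_eq]
  simp only [Finsupp.prod, mul_pow, Finset.prod_mul_distrib, map_prod, map_pow]
  ring

variable {σ K : Type*} [Field K]

/-- The element `t` of the torus multiplies the coordinate of `f` at `x ^ u` by the character
`t ^ u`, so a functional vanishing on `I` turns `f ∈ I` into a polynomial in `t` that vanishes on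
the whole torus, hence has no nonzero coefficient. -/
theorem isMonomialIdeal_of_aeval_C_mul_X_mem [Infinite K] {I : Ideal (MvPolynomial σ K)}
    (hI : ∀ t : σ → K, (∀ j, t j ≠ 0) → ∀ f ∈ I, aeval (fun j => C (t j) * X j) f ∈ I) :
    IsMonomialIdeal I := by
  classical
  intro f hf u hu
  suffices hquot : coeff u f • Ideal.Quotient.mkₐ K I (monomial u 1) = 0 from
    Ideal.Quotient.eq_zero_iff_mem.1 ((smul_eq_zero_iff_right (mem_support_iff.1 hu)).1 hquot)
  refine (Module.forall_dual_apply_eq_zero_iff K _).1 fun ℓ => ?_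
  let P : MvPolynomial σ K :=
    ∑ w ∈ f.support, monomial w (ℓ (Ideal.Quotient.mkₐ K I (monomial w (coeff w f))))
  have eval_P (t : σ → K) :
      eval t P = ℓ (Ideal.Quotient.mkₐ K I (aeval (fun j => C (t j) * X j) f)) := by
    conv_rhs => rw [f.as_sum]
    simp only [P, map_sum, aeval_C_mul_X_monomial, map_smul, eval_monomial, smul_eq_mul]
    exact Finset.sum_congr rfl fun w _ => mul_comm _ _
  have hP : P = 0 := by
    refine funext_set (fun _ => {0}ᶜ) (fun _ => (Set.finite_singleton 0).infinite_compl)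
      fun t ht => ?_
    have hmem := hI t (fun j => ht j trivial) f hf
    rw [eval_P, map_zero, Ideal.Quotient.mkₐ_eq_mk, Ideal.Quotient.eq_zero_iff_mem.2 hmem,
      map_zero]
  have hcoeff : coeff u P = ℓ (Ideal.Quotient.mkₐ K I (monomial u (coeff u f))) := by
    rw [coeff_sum, Finset.sum_eq_single_of_mem u hu fun w _ hwu => by
      rw [coeff_monomial, if_neg hwu], coeff_monomial, if_pos rfl]
  rw [← map_smul, smul_monomial, smul_eq_mul, mul_one, ← hcoeff, hP, coeff_zero]

theorem coordChange_eq_aeval_of_diagonal {n : ℕ} {g : GL (Fin n) K} {t : Fin n → K}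
    (hg : (g : Matrix (Fin n) (Fin n) K) = Matrix.diagonal t) :
    coordChange g = aeval fun j => C (t j) * X j := by
  refine algHom_ext fun j => ?_
  simp [coordChange, hg, Matrix.diagonal_apply, apply_ite C, ite_mul]

theorem IsBorelFixed.isMonomialIdeal [Infinite K] {n : ℕ} {I : Ideal (MvPolynomial (Fin n) K)}
    (hI : IsBorelFixed I) : IsMonomialIdeal I := by
  refine isMonomialIdeal_of_aeval_C_mul_X_mem fun t ht f hf => ?_
  have hdet : (Matrix.diagonal t).det ≠ 0 := by
    rw [Matrix.det_diagonal]
    exact Finset.prod_ne_zero_iff.2 fun j _ => ht j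
  let g : GL (Fin n) K := Matrix.GeneralLinearGroup.mkOfDetNeZero _ hdet
  have hg : (g : Matrix (Fin n) (Fin n) K) = Matrix.diagonal t := rfl
  rw [← coordChange_eq_aeval_of_diagonal hg, ← hI g (hg ▸ Matrix.blockTriangular_diagonal t)]
  exact Ideal.mem_map_of_mem _ hf

theorem IsMonomialIdeal.exists_X_pow_mem {I : Ideal (MvPolynomial σ K)}
    (hI : IsMonomialIdeal I) [Module.Finite K (MvPolynomial σ K ⧸ I)] (j : σ) :
    ∃ b, (X j : MvPolynomial σ K) ^ b ∈ I := by
  by_contra! hpow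
  have := hI.linearIndependent_mk_monomial.finite_of_isNoetherian
  let power (b : ℕ) : {u : σ →₀ ℕ // monomial u (1 : K) ∉ I} :=
    ⟨Finsupp.single j b, X_pow_eq_monomial (R := K) ▸ hpow b⟩
  exact not_injective_infinite_finite power fun b b' hb =>
    Finsupp.single_injective j (congrArg Subtype.val hb)

end MonomialIdeal

section Finiteness

theorem finite_linearMap_of_finite (K : Type*) {R N M : Type*} [CommRing K] [IsNoetherianRing K]
    [CommRing R] [Algebra K R] [AddCommGroup N] [Module R N] [Module.Finite R N]
    [AddCommGroup M] [Module R M] [Module K M] [IsScalarTower K R M] [Module.Finite K M] :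
    Module.Finite K (N →ₗ[R] M) := by
  obtain ⟨s, hs⟩ := Module.Finite.fg_top (R := R) (M := N)
  let evalGenerators : (N →ₗ[R] M) →ₗ[K] (s → M) :=
    { toFun := fun φ g => φ g
      map_add' := fun _ _ => rfl
      map_smul' := fun _ _ => rfl }
  exact Module.Finite.of_injective evalGenerators fun φ ψ h =>
    LinearMap.ext_on hs fun g hg => congrFun h ⟨g, hg⟩

theorem finite_tangentSpace {K : Type*} [Field K] {n : ℕ} (I : Ideal (MvPolynomial (Fin n) K))
    [Module.Finite K (MvPolynomial (Fin n) K ⧸ I)] : Module.Finite K (TangentSpace I) :=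
  finite_linearMap_of_finite K

end Finiteness

section FatPoint

variable {σ R : Type*} [CommRing R]

theorem finite_quotient_idealOfVars_pow [Finite σ] (r : ℕ) :
    Module.Finite R (MvPolynomial σ R ⧸ idealOfVars σ R ^ r) := by
  let mkLowDegree : restrictTotalDegree σ R r →ₗ[R] MvPolynomial σ R ⧸ idealOfVars σ R ^ r :=
    (Ideal.Quotient.mkₐ R _).toLinearMap ∘ₗ Submodule.subtype _
  refine Module.Finite.of_surjective mkLowDegree fun x => ?_
  obtain ⟨f, rfl⟩ := Ideal.Quotient.mk_surjective x
  have hdeg : ∑ i ∈ Finset.range r, homogeneousComponent i f ∈ restrictTotalDegree σ R r :=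
    Submodule.sum_mem _ fun i hi => (mem_restrictTotalDegree ..).2 <|
      (homogeneousComponent_isHomogeneous i f).totalDegree_le.trans (Finset.mem_range.1 hi).le
  refine ⟨⟨_, hdeg⟩, Ideal.Quotient.eq.2 <| (mem_pow_idealOfVars_iff' r _).2 fun u hu => ?_⟩
  simp [coeff_sum, coeff_homogeneousComponent, hu]

theorem finrank_homogeneousSubmodule [Nontrivial R] [Fintype σ] (m : ℕ) :
    Module.finrank R (homogeneousSubmodule σ R m) = (Fintype.card σ).multichoose m := by
  classical
  have hset : {u : σ →₀ ℕ | u.degree = m} =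
      (Finset.finsuppAntidiag Finset.univ m : Finset (σ →₀ ℕ)) := by
    ext u
    simp [Finset.mem_finsuppAntidiag, Finsupp.degree_eq_sum]
  rw [homogeneousSubmodule_eq_finsupp_supported, hset]
  refine (Module.finrank_eq_nat_card_basis (basisRestrictSupport R _)).trans ?_
  rw [Nat.card_eq_card_toFinset, Finset.toFinset_coe,
    Finset.card_finsuppAntidiag_nat_eq_multichoose, Finset.card_univ]

theorem mem_idealOfVars_pow_of_isHomogeneous {m : ℕ} {f : MvPolynomial σ R}
    (hf : f.IsHomogeneous m) : f ∈ idealOfVars σ R ^ m :=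
  (mem_pow_idealOfVars_iff' m f).2 fun _ hu => hf.coeff_eq_zero hu.ne

theorem homogeneousComponent_eq_zero_of_mem_idealOfVars_pow {m i : ℕ} {f : MvPolynomial σ R}
    (hf : f ∈ idealOfVars σ R ^ m) (hi : i < m) : homogeneousComponent i f = 0 := by
  ext u
  rw [coeff_homogeneousComponent, coeff_zero]
  exact ite_eq_right_iff.2 fun hu => (mem_pow_idealOfVars_iff' m f).1 hf u (hu ▸ hi)

theorem mul_sub_constantCoeff_smul_mem_idealOfVars_pow (g : MvPolynomial σ R) {m : ℕ}
    {f : MvPolynomial σ R} (hf : f ∈ idealOfVars σ R ^ m) :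
    g * f - constantCoeff g • f ∈ idealOfVars σ R ^ (m + 1) := by
  have hg : g - C (constantCoeff g) ∈ idealOfVars σ R := by
    rw [← pow_one (idealOfVars σ R)]
    refine (mem_pow_idealOfVars_iff' 1 _).2 fun u hu => ?_
    obtain rfl : u = 0 := (Finsupp.degree_eq_zero_iff u).1 (Nat.lt_one_iff.1 hu)
    simp [constantCoeff_eq]
  rw [smul_eq_C_mul, ← sub_mul, pow_succ']
  exact Ideal.mul_mem_mul hg hf

/-- `homogeneousComponent m` as a map into the module of forms of degree `m`. -/
noncomputable def formOfDegree (m : ℕ) : MvPolynomial σ R →ₗ[R] homogeneousSubmodule σ R m :=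
  (homogeneousComponent m).codRestrict _ (homogeneousComponent_mem m)

theorem formOfDegree_coe {m : ℕ} (f : homogeneousSubmodule σ R m) : formOfDegree m f.1 = f :=
  Subtype.ext (homogeneousComponent_eq_self f.2)

theorem formOfDegree_mul_of_mem_idealOfVars_pow (g : MvPolynomial σ R) {m : ℕ}
    {f : MvPolynomial σ R} (hf : f ∈ idealOfVars σ R ^ m) :
    formOfDegree m (g * f) = constantCoeff g • formOfDegree m f := by
  have hmem := mul_sub_constantCoeff_smul_mem_idealOfVars_pow g hf
  have hzero := homogeneousComponent_eq_zero_of_mem_idealOfVars_pow hmem m.lt_succ_self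
  rw [map_sub, map_smul, sub_eq_zero] at hzero
  exact Subtype.ext hzero

/-- The homomorphism `𝔪 ^ (r + 1) → S / 𝔪 ^ (r + 1)` induced by a linear map `ψ` from forms of
degree `r + 1` to forms of degree `r`: apply `ψ` to the component of degree `r + 1`. These are the
tangent vectors of degree `-1` at `𝔪 ^ (r + 1)`. -/
noncomputable def homOfFormsMap (r : ℕ) :
    (homogeneousSubmodule σ R (r + 1) →ₗ[R] homogeneousSubmodule σ R r) →ₗ[R]
      ((idealOfVars σ R ^ (r + 1) : Ideal (MvPolynomial σ R)) →ₗ[MvPolynomial σ R]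
        MvPolynomial σ R ⧸ idealOfVars σ R ^ (r + 1)) where
  toFun ψ :=
    { toFun := fun f => Ideal.Quotient.mk _ (ψ (formOfDegree (r + 1) f.1)).1
      map_add' := fun f g => by simp only [Submodule.coe_add, map_add]
      map_smul' := fun g f => by
        rw [Submodule.coe_smul, smul_eq_mul, formOfDegree_mul_of_mem_idealOfVars_pow g f.2,
          map_smul, Submodule.coe_smul]
        exact (Ideal.Quotient.eq.2 (mul_sub_constantCoeff_smul_mem_idealOfVars_pow g
          (mem_idealOfVars_pow_of_isHomogeneous (ψ _).2))).symm }
  map_add' _ _ := rfl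
  map_smul' _ _ := rfl

theorem homOfFormsMap_apply_coe {r : ℕ}
    (ψ : homogeneousSubmodule σ R (r + 1) →ₗ[R] homogeneousSubmodule σ R r)
    (f : homogeneousSubmodule σ R (r + 1)) :
    homOfFormsMap r ψ ⟨f.1, mem_idealOfVars_pow_of_isHomogeneous f.2⟩ =
      Ideal.Quotient.mk _ (ψ f).1 := by
  change Ideal.Quotient.mk _ (ψ (formOfDegree (r + 1) f.1)).1 = _
  rw [formOfDegree_coe]

theorem homOfFormsMap_injective (r : ℕ) :
    Function.Injective (homOfFormsMap (σ := σ) (R := R) r) := by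
  refine (injective_iff_map_eq_zero _).2 fun ψ hψ => LinearMap.ext fun f => Subtype.ext ?_
  have hmem : (ψ f).1 ∈ idealOfVars σ R ^ (r + 1) := by
    rw [← Ideal.Quotient.eq_zero_iff_mem, ← homOfFormsMap_apply_coe, hψ, LinearMap.zero_apply]
  have hzero := homogeneousComponent_eq_zero_of_mem_idealOfVars_pow hmem r.lt_succ_self
  rwa [homogeneousComponent_eq_self (ψ f).2] at hzero

theorem multichoose_mul_multichoose_le_finrank_tangentSpace (K : Type*) [Field K] (n r : ℕ) :
    n.multichoose (r + 1) * n.multichoose r ≤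
      Module.finrank K (TangentSpace (originIdeal K n ^ (r + 1))) := by
  have (m : ℕ) : Module.Finite K (homogeneousSubmodule (Fin n) K m) :=
    Module.Finite.of_fg (homogeneousSubmodule_fg (Fin n) K m)
  have : Module.Finite K (MvPolynomial (Fin n) K ⧸ originIdeal K n ^ (r + 1)) :=
    finite_quotient_idealOfVars_pow (r + 1)
  have := finite_tangentSpace (originIdeal K n ^ (r + 1))
  calc n.multichoose (r + 1) * n.multichoose r
      = Module.finrank K
          (homogeneousSubmodule (Fin n) K (r + 1) →ₗ[K] homogeneousSubmodule (Fin n) K r) := by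
        rw [Module.finrank_linearMap, finrank_homogeneousSubmodule, finrank_homogeneousSubmodule,
          Fintype.card_fin]
    _ ≤ Module.finrank K (TangentSpace (originIdeal K n ^ (r + 1))) :=
        LinearMap.finrank_le_finrank_of_injective (homOfFormsMap_injective r)

end FatPoint

section HilbertBurch

variable {R : Type*} (M : Type*) [CommRing R] [AddCommGroup M] [Module R M]
  (y z : R) (c : ℕ → ℕ) (a : ℕ)

/-- The map `M ^ (a + 1) → M ^ a` dual to the Hilbert–Burch matrix of the staircase ideal generated
by the `y ^ j * z ^ c j` for `j ≤ a`: its kernel consists of the tuples that respect the syzygies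
between neighbouring generators. -/
noncomputable def hilbertBurchMap : (Fin (a + 1) → M) →ₗ[R] (Fin a → M) :=
  LinearMap.pi fun j =>
    y • LinearMap.proj j.castSucc - z ^ (c j - c (j + 1)) • LinearMap.proj j.succ

variable {M}

theorem hilbertBurchMap_apply (m : Fin (a + 1) → M) (j : Fin a) :
    hilbertBurchMap M y z c a m j = y • m j.castSucc - z ^ (c j - c (j + 1)) • m j.succ :=
  rfl

variable (M) in
/-- The inclusion of the `j`-th factor of `M ^ a` followed by the projection to the cokernel of
`hilbertBurchMap`; it is zero for `a ≤ j`. -/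
noncomputable def hilbertBurchClass (j : ℕ) :
    M →ₗ[R] (Fin a → M) ⧸ LinearMap.range (hilbertBurchMap M y z c a) :=
  Submodule.mkQ _ ∘ₗ LinearMap.pi fun k : Fin a => if (k : ℕ) = j then LinearMap.id else 0

theorem hilbertBurchClass_apply (j : ℕ) (m : M) :
    hilbertBurchClass M y z c a j m =
      Submodule.mkQ _ fun k : Fin a => if (k : ℕ) = j then m else 0 := by
  refine congrArg (Submodule.mkQ _) (funext fun k => ?_)
  rw [LinearMap.pi_apply]
  split_ifs <;> rfl

theorem hilbertBurchClass_of_le {j : ℕ} (hj : a ≤ j) :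
    hilbertBurchClass M y z c a j = 0 := by
  have hne (k : Fin a) : (k : ℕ) ≠ j := (k.2.trans_le hj).ne
  ext m
  simp only [hilbertBurchClass_apply, hne, if_false]
  exact map_zero _

theorem mkQ_eq_sum_hilbertBurchClass (m : Fin a → M) :
    Submodule.mkQ (LinearMap.range (hilbertBurchMap M y z c a)) m =
      ∑ j : Fin a, hilbertBurchClass M y z c a j (m j) := by
  simp only [hilbertBurchClass_apply, ← map_sum]
  congr 1
  ext k
  simp [Fin.val_inj, Finset.sum_apply]

theorem smul_hilbertBurchClass_zero (m : M) : y • hilbertBurchClass M y z c a 0 m = 0 := by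
  rw [← map_smul, hilbertBurchClass_apply]
  refine (Submodule.Quotient.mk_eq_zero _).2 ⟨fun k => if (k : ℕ) = 0 then m else 0, ?_⟩
  ext k
  simp only [hilbertBurchMap_apply, Fin.val_castSucc, Fin.val_succ, Nat.succ_ne_zero, if_false,
    smul_zero, sub_zero, smul_ite]

theorem smul_hilbertBurchClass_succ (j : ℕ) (m : M) :
    y • hilbertBurchClass M y z c a (j + 1) m =
      z ^ (c j - c (j + 1)) • hilbertBurchClass M y z c a j m := by
  rw [← map_smul, ← map_smul, hilbertBurchClass_apply, hilbertBurchClass_apply]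
  refine (Submodule.Quotient.eq _).2 ⟨fun k => if (k : ℕ) = j + 1 then m else 0, ?_⟩
  ext k
  rw [hilbertBurchMap_apply]
  by_cases hk : (k : ℕ) = j
  · simp [hk]
  · by_cases hk' : (k : ℕ) = j + 1 <;> simp [hk, hk']

variable {c}

/-- Moving `z ^ c j` down the staircase with the syzygies ends at index `a`, where the class is
zero. -/
theorem pow_smul_hilbertBurchClass (hc : Antitone c) (j : ℕ) (m : M) :
    z ^ c j • hilbertBurchClass M y z c a j m = 0 := by
  by_cases hj : a ≤ j
  · rw [hilbertBurchClass_of_le y z c a hj, LinearMap.zero_apply, smul_zero]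
  · calc z ^ c j • hilbertBurchClass M y z c a j m
        = z ^ c (j + 1) • z ^ (c j - c (j + 1)) • hilbertBurchClass M y z c a j m := by
          rw [smul_smul, ← pow_add, Nat.add_sub_cancel' (hc j.le_succ)]
      _ = y • z ^ c (j + 1) • hilbertBurchClass M y z c a (j + 1) m := by
          rw [← smul_hilbertBurchClass_succ, smul_comm]
      _ = 0 := by rw [pow_smul_hilbertBurchClass hc (j + 1) m, smul_zero]
termination_by a - j

section Span

variable (K : Type*) [CommRing K] [Algebra K R] [Module K M] [IsScalarTower K R M] {ι : Type*}
  (v : ι → M)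

variable (c) in
/-- The `K`-span of the classes of `z ^ t • v l` placed at index `j`, over the boxes `(j, t)` with
`t < c j` under the staircase. -/
noncomputable def hilbertBurchSpan :
    Submodule K ((Fin a → M) ⧸ LinearMap.range (hilbertBurchMap M y z c a)) :=
  Submodule.span K (Set.range fun q : (Σ j : Fin a, Fin (c j)) × ι =>
    z ^ (q.1.2 : ℕ) • hilbertBurchClass M y z c a q.1.1 (v q.2))

theorem pow_smul_hilbertBurchClass_mem_span (hc : Antitone c) (j t : ℕ) (l : ι) :
    z ^ t • hilbertBurchClass M y z c a j (v l) ∈ hilbertBurchSpan y z c a K v := by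
  by_cases hj : a ≤ j
  · rw [hilbertBurchClass_of_le y z c a hj, LinearMap.zero_apply, smul_zero]
    exact zero_mem _
  by_cases ht : t < c j
  · exact Submodule.subset_span ⟨(⟨⟨j, not_le.1 hj⟩, ⟨t, ht⟩⟩, l), rfl⟩
  · rw [← Nat.sub_add_cancel (not_lt.1 ht), pow_add, mul_smul,
      pow_smul_hilbertBurchClass y z a hc, smul_zero]
    exact zero_mem _

theorem smul_pow_smul_hilbertBurchClass_mem_span (hc : Antitone c) {r : R}
    (hr : r ∈ ({y, z} : Set R)) (j t : ℕ) (l : ι) :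
    r • z ^ t • hilbertBurchClass M y z c a j (v l) ∈ hilbertBurchSpan y z c a K v := by
  obtain rfl | rfl := hr
  · rw [smul_comm]
    cases j with
    | zero =>
      rw [smul_hilbertBurchClass_zero, smul_zero]
      exact zero_mem _
    | succ j =>
      rw [smul_hilbertBurchClass_succ, smul_smul, ← pow_add]
      exact pow_smul_hilbertBurchClass_mem_span _ z a K v hc j _ l
  · rw [smul_smul, ← pow_succ']
    exact pow_smul_hilbertBurchClass_mem_span y _ a K v hc j _ l

theorem smul_mem_hilbertBurchSpan (hc : Antitone c) {r : R} (hr : r ∈ Algebra.adjoin K {y, z}) :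
    ∀ w ∈ hilbertBurchSpan y z c a K v, r • w ∈ hilbertBurchSpan y z c a K v := by
  induction hr using Algebra.adjoin_induction with
  | mem r hr =>
    intro w hw
    induction hw using Submodule.span_induction with
    | mem w hw =>
      obtain ⟨⟨⟨j, t⟩, l⟩, rfl⟩ := hw
      exact smul_pow_smul_hilbertBurchClass_mem_span y z a K v hc hr j t l
    | zero =>
      rw [smul_zero]
      exact zero_mem _
    | add w w' _ _ hw hw' => exact smul_add r w w' ▸ add_mem hw hw'
    | smul k w _ hw => exact smul_comm k r w ▸ Submodule.smul_mem _ k hw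
  | algebraMap k => exact fun w hw => (algebraMap_smul R k w).symm ▸ Submodule.smul_mem _ k hw
  | add r s _ _ hr hs => exact fun w hw => add_smul r s w ▸ add_mem (hr w hw) (hs w hw)
  | mul r s _ _ hr hs => exact fun w hw => mul_smul r s w ▸ hr _ (hs w hw)

theorem hilbertBurchSpan_eq_top (hc : Antitone c)
    (hv : Submodule.span (Algebra.adjoin K {y, z}) (Set.range v) = ⊤) :
    hilbertBurchSpan y z c a K v = ⊤ := by
  have hclass (j : ℕ) (m : M) : hilbertBurchClass M y z c a j m ∈ hilbertBurchSpan y z c a K v := by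
    have hm : m ∈ Submodule.span (Algebra.adjoin K {y, z}) (Set.range v) := hv ▸ trivial
    induction hm using Submodule.span_induction with
    | mem m hm =>
      obtain ⟨l, rfl⟩ := hm
      simpa using pow_smul_hilbertBurchClass_mem_span y z a K v hc j 0 l
    | zero => rw [map_zero]; exact zero_mem _
    | add m m' _ _ hm hm' => rw [map_add]; exact add_mem hm hm'
    | smul r m _ hm =>
      rw [Subalgebra.smul_def, map_smul]
      exact smul_mem_hilbertBurchSpan y z a K v hc r.2 _ hm
  refine (Submodule.eq_top_iff').2 fun x => ?_
  obtain ⟨m, rfl⟩ := Submodule.mkQ_surjective _ x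
  rw [mkQ_eq_sum_hilbertBurchClass]
  exact Submodule.sum_mem _ fun j _ => hclass j (m j)

end Span

theorem finrank_ker_hilbertBurchMap_le (K : Type*) [Field K] [Algebra K R] [Module K M]
    [IsScalarTower K R M] [Module.Finite K M] {ι : Type*} [Fintype ι] (v : ι → M) (hc : Antitone c)
    (hv : Submodule.span (Algebra.adjoin K {y, z}) (Set.range v) = ⊤) :
    Module.finrank K (LinearMap.ker (hilbertBurchMap M y z c a)) ≤
      Module.finrank K M + Fintype.card ι * ∑ j : Fin a, c j := by
  let D : (Fin (a + 1) → M) →ₗ[K] (Fin a → M) := (hilbertBurchMap M y z c a).restrictScalars K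
  have hcoker : Module.finrank K ((Fin a → M) ⧸ D.range) ≤
      Fintype.card ι * ∑ j : Fin a, c j := by
    have hcard := finrank_range_le_card (R := K) fun q : (Σ j : Fin a, Fin (c j)) × ι =>
      z ^ (q.1.2 : ℕ) • hilbertBurchClass M y z c a q.1.1 (v q.2)
    rw [Set.finrank, ← hilbertBurchSpan, hilbertBurchSpan_eq_top y z a K v hc hv,
      finrank_top] at hcard
    change Module.finrank K ((Fin a → M) ⧸ D.range) ≤ _ at hcard
    simpa [mul_comm] using hcard
  have hsource : Module.finrank K D.range + Module.finrank K (LinearMap.ker D) =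
      a * Module.finrank K M + Module.finrank K M := by
    simpa [Module.finrank_pi_fintype, add_mul] using D.finrank_range_add_finrank_ker
  have htarget : Module.finrank K ((Fin a → M) ⧸ D.range) +
      Module.finrank K D.range = a * Module.finrank K M := by
    simpa [Module.finrank_pi_fintype] using (D.range).finrank_quotient_add_finrank
  change Module.finrank K (LinearMap.ker D) ≤ _
  omega

end HilbertBurch

section Staircase

variable {K : Type*} [CommRing K] {I : Ideal (MvPolynomial (Fin 3) K)}

theorem monomial_fin_three (u : Fin 3 →₀ ℕ) (a : K) :
    monomial u a = C a * (X 0 ^ u 0 * X 1 ^ u 1 * X 2 ^ u 2) := by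
  rw [monomial_eq, Finsupp.prod_fintype _ _ fun _ => pow_zero _, Fin.prod_univ_three]

/-- The least `c` such that `x ^ i * y ^ j * z ^ c ∈ I`; it is the junk value `0` if there is no
such `c`. -/
noncomputable def stairHeight (I : Ideal (MvPolynomial (Fin 3) K)) (i j : ℕ) : ℕ :=
  sInf {c | X 0 ^ i * X 1 ^ j * X 2 ^ c ∈ I}

/-- The monomial `x ^ i * y ^ j * z ^ c` with `c = stairHeight I i j`. For a monomial ideal and
fixed `i`, these generate the slice of `I` in `x`-degree `i`. -/
noncomputable def stairCorner (I : Ideal (MvPolynomial (Fin 3) K)) (i j : ℕ) :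
    MvPolynomial (Fin 3) K :=
  X 0 ^ i * X 1 ^ j * X 2 ^ stairHeight I i j

theorem stairHeight_le {i j c : ℕ} (h : X 0 ^ i * X 1 ^ j * X 2 ^ c ∈ I) :
    stairHeight I i j ≤ c :=
  Nat.sInf_le h

theorem stairHeight_eq_zero {a : ℕ} (ha : X 1 ^ a ∈ I) (i : ℕ) : stairHeight I i a = 0 :=
  Nat.le_zero.1 <| stairHeight_le <| I.mul_mem_right _ <| I.mul_mem_left _ ha

theorem stairCorner_mem (hz : ∃ b, X 2 ^ b ∈ I) (i j : ℕ) : stairCorner I i j ∈ I := by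
  obtain ⟨b, hb⟩ := hz
  exact Nat.sInf_mem (s := {c | X 0 ^ i * X 1 ^ j * X 2 ^ c ∈ I}) ⟨b, I.mul_mem_left _ hb⟩

theorem antitone_stairHeight (hz : ∃ b, X 2 ^ b ∈ I) (i : ℕ) : Antitone (stairHeight I i) := by
  refine antitone_nat_of_succ_le fun j => stairHeight_le <|
    I.mem_of_dvd (mul_dvd_mul_right (mul_dvd_mul_left _ ?_) _) (stairCorner_mem hz i j)
  exact pow_dvd_pow _ j.le_succ

theorem X_one_mul_stairCorner (hz : ∃ b, X 2 ^ b ∈ I) (i j : ℕ) :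
    X 1 * stairCorner I i j =
      X 2 ^ (stairHeight I i j - stairHeight I i (j + 1)) * stairCorner I i (j + 1) := by
  have hpow : (X 2 : MvPolynomial (Fin 3) K) ^ stairHeight I i j =
      X 2 ^ (stairHeight I i j - stairHeight I i (j + 1)) * X 2 ^ stairHeight I i (j + 1) := by
    rw [← pow_add, Nat.sub_add_cancel (antitone_stairHeight hz i j.le_succ)]
  rw [stairCorner, stairCorner, hpow]
  ring

theorem le_of_stairCorner_mem (hI : IsMonomialIdeal I) {p a : ℕ} (ha : X 1 ^ a ∈ I)
    {N : Ideal (MvPolynomial (Fin 3) K)} (hx : X 0 ^ p ∈ N)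
    (hN : ∀ i < p, ∀ j ≤ a, stairCorner I i j ∈ N) : I ≤ N := by
  intro f hf
  rw [f.as_sum]
  refine N.sum_mem fun u hu => ?_
  have hu := hI f hf u hu
  rw [monomial_fin_three, C_1, one_mul] at hu
  rw [monomial_fin_three]
  refine N.mul_mem_left _ ?_
  obtain hpu | hup := le_or_gt p (u 0)
  · exact N.mul_mem_right _ (N.mul_mem_right _ (N.pow_mem_of_pow_mem hx hpu))
  obtain hau | hua := le_or_gt a (u 1)
  · refine N.mem_of_dvd (mul_dvd_mul (mul_dvd_mul_left _ (pow_dvd_pow _ hau)) ?_)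
      (hN (u 0) hup a le_rfl)
    rw [stairHeight_eq_zero ha, pow_zero]
    exact one_dvd _
  · exact N.mem_of_dvd (mul_dvd_mul_left _ (pow_dvd_pow _ (stairHeight_le hu)))
      (hN (u 0) hup (u 1) hua.le)

theorem linearMap_eq_zero_of_stairCorner {M : Type*} [AddCommGroup M]
    [Module (MvPolynomial (Fin 3) K) M] (hI : IsMonomialIdeal I) {p a : ℕ} (ha : X 1 ^ a ∈ I)
    (hx : X 0 ^ p ∈ I) (hz : ∃ b, X 2 ^ b ∈ I) {φ : I →ₗ[MvPolynomial (Fin 3) K] M}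
    (hφx : φ ⟨_, hx⟩ = 0) (hφ : ∀ i < p, ∀ j ≤ a, φ ⟨_, stairCorner_mem hz i j⟩ = 0) : φ = 0 := by
  have hle := le_of_stairCorner_mem (N := (LinearMap.ker φ).map I.subtype) hI ha
    ⟨⟨_, hx⟩, hφx, rfl⟩ fun i hi j hj => ⟨⟨_, stairCorner_mem hz i j⟩, hφ i hi j hj, rfl⟩
  ext f
  obtain ⟨g, hg, hgf⟩ := hle f.2
  rwa [Subtype.ext hgf] at hg

theorem span_adjoin_range_mk_X_zero_pow {p : ℕ} (hx : X 0 ^ p ∈ I) :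
    Submodule.span (Algebra.adjoin K {(X 1 : MvPolynomial (Fin 3) K), X 2})
      (Set.range fun l : Fin p => Ideal.Quotient.mk I (X 0 ^ (l : ℕ))) = ⊤ := by
  refine Submodule.eq_top_iff'.2 fun w => ?_
  obtain ⟨f, rfl⟩ := Ideal.Quotient.mk_surjective w
  rw [f.as_sum, map_sum]
  refine Submodule.sum_mem _ fun u _ => ?_
  obtain hpu | hup := le_or_gt p (u 0)
  · have hmem : monomial u (coeff u f) ∈ I := by
      rw [monomial_fin_three]
      exact I.mul_mem_left _ <| I.mul_mem_right _ <| I.mul_mem_right _ <|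
        I.pow_mem_of_pow_mem hx hpu
    rw [Ideal.Quotient.eq_zero_iff_mem.2 hmem]
    exact zero_mem _
  · have hr : coeff u f • (X 1 ^ u 1 * X 2 ^ u 2) ∈
        Algebra.adjoin K {(X 1 : MvPolynomial (Fin 3) K), X 2} :=
      Subalgebra.smul_mem _ (mul_mem (pow_mem (Algebra.subset_adjoin (by simp)) _)
        (pow_mem (Algebra.subset_adjoin (by simp)) _)) _
    have hmul : monomial u (coeff u f) =
        coeff u f • (X 1 ^ u 1 * X 2 ^ u 2) * X 0 ^ u 0 := by
      rw [monomial_fin_three, smul_eq_C_mul]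
      ring
    rw [hmul]
    exact Submodule.smul_mem _ (Subtype.mk _ hr)
      (Submodule.subset_span (Set.mem_range_self (Fin.mk (u 0) hup)))

end Staircase

section TangentSpaceBound

variable {K : Type*} [Field K] {I : Ideal (MvPolynomial (Fin 3) K)}

theorem sum_stairHeight_le (hI : IsMonomialIdeal I)
    [Module.Finite K (MvPolynomial (Fin 3) K ⧸ I)] (p a : ℕ) :
    ∑ i : Fin p, ∑ j : Fin a, stairHeight I i j ≤
      Module.finrank K (MvPolynomial (Fin 3) K ⧸ I) := by
  let exponent (q : Σ i : Fin p, Σ j : Fin a, Fin (stairHeight I i j)) :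
      {u : Fin 3 →₀ ℕ // monomial u (1 : K) ∉ I} :=
    ⟨Finsupp.equivFunOnFinite.symm ![q.1, q.2.1, q.2.2], by
      rw [monomial_fin_three, C_1, one_mul]
      exact Nat.notMem_of_lt_sInf q.2.2.2⟩
  have hinj : Function.Injective exponent := by
    rintro ⟨i, j, t⟩ ⟨i', j', t'⟩ h
    have hfun := Finsupp.equivFunOnFinite.symm.injective (congrArg Subtype.val h)
    obtain rfl : i = i' := Fin.ext (congrFun hfun 0)
    obtain rfl : j = j' := Fin.ext (congrFun hfun 1)
    obtain rfl : t = t' := Fin.ext (congrFun hfun 2)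
    rfl
  simpa using (hI.linearIndependent_mk_monomial.comp exponent hinj).fintype_card_le_finrank

/-- The `k[y, z]`-linear maps from the slice of `I` in `x`-degree `i` to `S / I`, encoded by their
values on the generators `stairCorner I i j` with `j ≤ a`; here `y ^ a ∈ I`. -/
noncomputable abbrev sliceHom (I : Ideal (MvPolynomial (Fin 3) K)) (a i : ℕ) :
    Submodule (MvPolynomial (Fin 3) K) (Fin (a + 1) → MvPolynomial (Fin 3) K ⧸ I) :=
  LinearMap.ker (hilbertBurchMap _ (X 1 : MvPolynomial (Fin 3) K) (X 2) (stairHeight I i) a)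

/-- The restriction of a tangent vector to the slice of `I` in `x`-degree `i`. -/
noncomputable def tangentSlice (hz : ∃ b, X 2 ^ b ∈ I) (a i : ℕ) :
    TangentSpace I →ₗ[MvPolynomial (Fin 3) K] sliceHom I a i where
  toFun φ := ⟨fun j => φ ⟨_, stairCorner_mem hz i j⟩, by
    rw [LinearMap.mem_ker]
    ext j
    rw [hilbertBurchMap_apply, Pi.zero_apply, sub_eq_zero, ← map_smul, ← map_smul]
    exact congrArg φ (Subtype.ext (X_one_mul_stairCorner hz i j))⟩
  map_add' _ _ := rfl
  map_smul' _ _ := rfl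

/-- The values of a tangent vector on `x ^ p` and on the slices of `I` in `x`-degree below `p`. -/
noncomputable def tangentValues {p : ℕ} (hx : X 0 ^ p ∈ I) (hz : ∃ b, X 2 ^ b ∈ I) (a : ℕ) :
    TangentSpace I →ₗ[MvPolynomial (Fin 3) K]
      (Π i : Fin p, sliceHom I a i) × (MvPolynomial (Fin 3) K ⧸ I) :=
  (LinearMap.pi fun i : Fin p => tangentSlice hz a i).prod (LinearMap.applyₗ ⟨_, hx⟩)

theorem tangentValues_injective (hI : IsMonomialIdeal I) {p a : ℕ} (hx : X 0 ^ p ∈ I)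
    (ha : X 1 ^ a ∈ I) (hz : ∃ b, X 2 ^ b ∈ I) : Function.Injective (tangentValues hx hz a) := by
  refine (injective_iff_map_eq_zero _).2 fun φ hφ => ?_
  refine linearMap_eq_zero_of_stairCorner hI ha hx hz (congrArg Prod.snd hφ) fun i hi j hj => ?_
  have hslice : tangentSlice hz a i φ = 0 := congrFun (congrArg Prod.fst hφ) ⟨i, hi⟩
  exact congrFun (congrArg Subtype.val hslice) ⟨j, Nat.lt_succ_of_le hj⟩

theorem finrank_tangentSpace_le (hI : IsMonomialIdeal I)
    [Module.Finite K (MvPolynomial (Fin 3) K ⧸ I)] {p : ℕ} (hx : X 0 ^ p ∈ I) :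
    Module.finrank K (TangentSpace I) ≤
      (2 * p + 1) * Module.finrank K (MvPolynomial (Fin 3) K ⧸ I) := by
  obtain ⟨a, ha⟩ := hI.exists_X_pow_mem 1
  have hz := hI.exists_X_pow_mem 2
  set d := Module.finrank K (MvPolynomial (Fin 3) K ⧸ I)
  have (i : ℕ) : Module.Finite K (sliceHom I a i) :=
    Module.Finite.of_injective ((sliceHom I a i).subtype.restrictScalars K) Subtype.val_injective
  have hslice (i : ℕ) :
      Module.finrank K (sliceHom I a i) ≤ d + p * ∑ j : Fin a, stairHeight I i j := by
    simpa using finrank_ker_hilbertBurchMap_le (X 1) (X 2) a K _ (antitone_stairHeight hz i)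
      (span_adjoin_range_mk_X_zero_pow hx)
  calc Module.finrank K (TangentSpace I)
      ≤ Module.finrank K ((Π i : Fin p, sliceHom I a i) × (MvPolynomial (Fin 3) K ⧸ I)) :=
        LinearMap.finrank_le_finrank_of_injective
          (f := (tangentValues hx hz a).restrictScalars K) (tangentValues_injective hI hx ha hz)
    _ = (∑ i : Fin p, Module.finrank K (sliceHom I a i)) + d := by
        rw [Module.finrank_prod, Module.finrank_pi_fintype]
    _ ≤ (∑ i : Fin p, (d + p * ∑ j : Fin a, stairHeight I i j)) + d := by
        gcongr with i
        exact hslice i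
    _ = p * d + p * (∑ i : Fin p, ∑ j : Fin a, stairHeight I i j) + d := by
        simp [Finset.sum_add_distrib, Finset.mul_sum]
    _ ≤ p * d + p * d + d := by
        gcongr
        exact sum_stairHeight_le hI p a
    _ = (2 * p + 1) * d := by ring

end TangentSpaceBound

theorem mul_choose_three_le_multichoose_mul {p r : ℕ} (hp : 4 * p ≤ 3 * (r + 1) + 1) :
    (2 * p + 1) * (r + 3).choose 3 ≤ Nat.multichoose 3 (r + 1) * Nat.multichoose 3 r := by
  have hchoose (m : ℕ) : Nat.multichoose 3 m = (m + 2).choose 2 := by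
    rw [Nat.multichoose_eq, show 3 + m - 1 = 2 + m by omega, add_comm m 2, Nat.choose_symm_add]
  have hthree : (r + 3).choose 3 * 3 = (r + 3) * (r + 2).choose 2 :=
    (Nat.add_one_mul_choose_eq ..).symm
  have htwo : (r + 3).choose 2 * 2 = (r + 3) * (r + 2) := by
    rw [← Nat.add_one_mul_choose_eq, Nat.choose_one_right]
  rw [hchoose, hchoose]
  refine Nat.le_of_mul_le_mul_left (c := 6) ?_ (by norm_num)
  calc 6 * ((2 * p + 1) * (r + 3).choose 3)
      = 2 * (2 * p + 1) * ((r + 3).choose 3 * 3) := by ring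
    _ ≤ 3 * (r + 2) * ((r + 3).choose 3 * 3) := Nat.mul_le_mul_right _ (by omega)
    _ = 3 * ((r + 3) * (r + 2)) * (r + 2).choose 2 := by rw [hthree]; ring
    _ = 6 * ((r + 3).choose 2 * (r + 2).choose 2) := by rw [← htwo]; ring

end HilbPoints

theorem mainTheorem10_general {K : Type*} [Field K] (d r p : ℕ)
    (I : Ideal (MvPolynomial (Fin 3) K))
    (hI : HilbPoints.IsHilbPoint d I) (hmon : HilbPoints.IsMonomialIdeal I)
    (hd : d ≤ (r + 2).choose 3)
    (hx : (MvPolynomial.X 0 : MvPolynomial (Fin 3) K) ^ p ∈ I)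
    (hp : (p : ℚ) ≤ (3 * (r : ℚ) + 1) / 4) :
    Module.Finite K (HilbPoints.TangentSpace I) ∧
    Module.Finite K (HilbPoints.TangentSpace (HilbPoints.originIdeal K 3 ^ r)) ∧
    Module.finrank K (HilbPoints.TangentSpace I) ≤
      Module.finrank K (HilbPoints.TangentSpace (HilbPoints.originIdeal K 3 ^ r)) := by
  obtain ⟨_, rfl⟩ := hI
  have : Module.Finite K (MvPolynomial (Fin 3) K ⧸ HilbPoints.originIdeal K 3 ^ r) :=
    HilbPoints.finite_quotient_idealOfVars_pow r
  refine ⟨HilbPoints.finite_tangentSpace I, HilbPoints.finite_tangentSpace _,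
    (HilbPoints.finrank_tangentSpace_le hmon hx).trans ?_⟩
  rw [le_div_iff₀ (by norm_num)] at hp
  norm_cast at hp
  obtain _ | r := r
  · simp [Nat.le_zero.1 hd]
  · calc (2 * p + 1) * Module.finrank K (MvPolynomial (Fin 3) K ⧸ I)
        ≤ (2 * p + 1) * (r + 3).choose 3 := Nat.mul_le_mul_left _ hd
      _ ≤ Nat.multichoose 3 (r + 1) * Nat.multichoose 3 r :=
          HilbPoints.mul_choose_three_le_multichoose_mul (by omega)
      _ ≤ Module.finrank K (HilbPoints.TangentSpace (HilbPoints.originIdeal K 3 ^ (r + 1))) :=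
          HilbPoints.multichoose_mul_multichoose_le_finrank_tangentSpace K 3 r

theorem mainTheorem10 {K : Type*} [Field K] [CharZero K] (d r p : ℕ)
    (I : Ideal (MvPolynomial (Fin 3) K))
    (hI : HilbPoints.IsHilbPoint d I) (hB : HilbPoints.IsBorelFixed I)
    (hd : d ≤ (r + 2).choose 3)
    (hx : (MvPolynomial.X 0 : MvPolynomial (Fin 3) K) ^ p ∈ I)
    (hp : (p : ℚ) ≤ (3 * (r : ℚ) + 1) / 4) :
    Module.Finite K (HilbPoints.TangentSpace I) ∧
    Module.Finite K (HilbPoints.TangentSpace (HilbPoints.originIdeal K 3 ^ r)) ∧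
    Module.finrank K (HilbPoints.TangentSpace I) ≤
      Module.finrank K (HilbPoints.TangentSpace (HilbPoints.originIdeal K 3 ^ r)) :=
  mainTheorem10_general d r p I hI hB.isMonomialIdeal hd hx hp
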